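/- \textbf{Setting.} Let $\mathcal B$ be a uniformly convex complex Banach space with a Schauder basis $(\mathcal E_n)_{n\ge 1}$, $\|\mathcal E_n\|_{\mathcal B}=1$, and let $\mathcal E_n^*\in\mathcal B'$ be its coordinate functionals. Let $\mathcal H$ be the completion of $\mathcal B$ with respect to the inner product $$(u,v)_{\mathcal H}=\sum_{n\ge1}2^{-n}\langle \mathcal E_n^*,u\rangle\overline{\langle \mathcal E_n^*,v\rangle},$$ so that $\mathcal B\subset\mathcal H$ continuously and densely. For $u\in\mathcal B$ let $\mathbf J_{\mathcal B}(u)=(\,\cdot\,,u)_{\mathcal H}|_{\mathcal B}\in\mathcal B'$. For a bounded operator $A$ on $\mathcal B$ with transpose $A'$ on $\mathcal B'$, the adjoint on $\mathcal B$ is $A^*=\mathbf J_{\mathcal B}^{-1}A'\mathbf J_{\mathcal B}$, with domain $D(A^*)=\{v\in\mathcal B: A'\mathbf J_{\mathcal B}(v)\in\mathbf J_{\mathcal B}(\mathcal B)\}$. Let $0<p<\infty$. The Schatten class $\mathbb S_p[\mathcal H]$ consists of the compact operators $T$ on $\mathcal H$ with $\|T\|_p^{\mathcal H}=\{\mathrm{Tr}\,[T^*T]^{p/2}\}^{1/p}<\infty$.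 Let $\mathbb S_p[\mathcal B]$ be the set of bounded operators $A$ on $\mathcal B$ that are restrictions to $\mathcal B$ of operators in $\mathbb S_p[\mathcal H]$; the (unique) bounded extension of $A$ to $\mathcal H$ is denoted by $\bar A$. A \emph{singular system of $\bar A$ in $\mathcal B$} is a family $(\bar\varphi_i)_{i\in I}$ of vectors of $\mathcal B$ that is orthonormal in $\mathcal H$, together with numbers $\mu_i$, such that $|\bar A|\bar\varphi_i=\mu_i\bar\varphi_i$ for all $i$ and $|\bar A|x=\sum_i\mu_i(x,\bar\varphi_i)_{\mathcal H}\,\bar\varphi_i$ for all $x\in\mathcal H$, where $|\bar A|=[\bar A^*\bar A]^{1/2}$. For such a system put $\varphi_i=\bar\varphi_i/\|\bar\varphi_i\|_{\mathcal B}$, and let $\varphi_i^*\in\mathcal B'$ be a functional associated with $\varphi_i$: either one with $\langle\varphi_i,\varphi_i^*\rangle=\|\varphi_i\|_{\mathcal B}^2=\|\varphi_i^*\|_{\mathcal B'}^2$ (a value of the duality map), or the normalized representing functional $\varphi_i^*=\mathbf J_{\mathcal B}(\varphi_i)/\|\varphi_i\|_{\mathcal H}^2$. Given these data, the Schatten norm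 of $A$ on $\mathcal B$ is $$\|A\|_p^{\mathcal B}=\Big\{\sum_{i}\langle A^*A\varphi_i,\varphi_i^*\rangle^{p/2}\Big\}^{1/p}.$$ \textbf{Theorem.} Let $A\in\mathbb S_p[\mathcal B]$, with extension $\bar A$ to $\mathcal H$. (1) For every singular system of $\bar A$ in $\mathcal B$ one has $A\varphi_i\in D(A^*)$ for all $i$, and for every choice of the associated functionals $\varphi_i^*$ the numbers $\langle A^*A\varphi_i,\varphi_i^*\rangle$ are real and nonnegative and $$\|A\|_p^{\mathcal B}=\|\bar A\|_p^{\mathcal H}<\infty .$$ In particular, $\|A\|_p^{\mathcal B}$ does not depend on the choices made. (2) If $A$ is compact on $\mathcal B$ and $D(A^*)=\mathcal B$, then a singular system of $\bar A$ in $\mathcal B$ exists. -/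

import Mathlib

open scoped ENNReal ComplexConjugate ComplexOrder

noncomputable section

/-! ### Normalized Schauder bases -/

/-- A Schauder basis (with its coordinate functionals) all of whose vectors have norm one. -/
structure SBasis (B : Type*) [NormedAddCommGroup B] [NormedSpace ℂ B] where
  toBasis : SchauderBasis ℂ B
  norm_basis : ∀ n, ‖toBasis n‖ = 1

namespace SBasis

variable {B : Type*} [NormedAddCommGroup B] [NormedSpace ℂ B]

/-- The coordinate functionals of the basis. -/
def coord (b : SBasis B) (n : ℕ) : StrongDual ℂ B := b.toBasis.coord n

/-- The weights `2⁻¹, 2⁻², …`; the first basis vector has index `0`. -/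
def weight (n : ℕ) : ℝ := (1 / 2 : ℝ) ^ (n + 1)

theorem weight_pos (n : ℕ) : 0 < weight n := by unfold weight; positivity

theorem hasSum_weight : HasSum weight 1 := by
  have h := (hasSum_geometric_two).mul_left (1 / 2 : ℝ)
  have e : weight = fun n => (1 / 2 : ℝ) * (1 / 2 : ℝ) ^ n := by
    funext n; simp only [weight]; ring
  rw [e]
  rwa [show (1 / 2 : ℝ) * 2 = 1 by norm_num] at h

theorem exists_coord_bound [CompleteSpace B] (b : SBasis B) :
    ∃ C : ℝ, 0 ≤ C ∧ ∀ n u, ‖b.coord n u‖ ≤ C * ‖u‖ := by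
  obtain ⟨C, hC⟩ := SchauderBasis.exists_norm_proj_le b.toBasis
  have hC0 : 0 ≤ C := (norm_nonneg _).trans (hC 0)
  refine ⟨2 * C, by positivity, fun n u => ?_⟩
  have h1 : b.coord n u • b.toBasis n
      = SchauderBasis.proj b.toBasis (n + 1) u - SchauderBasis.proj b.toBasis n u := by
    simp [SchauderBasis.proj_apply, Finset.sum_range_succ, coord]
  have h2 : ‖b.coord n u‖ = ‖b.coord n u • b.toBasis n‖ := by
    rw [norm_smul, b.norm_basis, mul_one]
  rw [h2, h1]
  have h3 := (SchauderBasis.proj b.toBasis (n + 1)).le_of_opNorm_le (hC _) u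
  have h4 := (SchauderBasis.proj b.toBasis n).le_of_opNorm_le (hC _) u
  linarith [norm_sub_le (SchauderBasis.proj b.toBasis (n + 1) u)
    (SchauderBasis.proj b.toBasis n u)]

theorem eq_zero_of_coord (b : SBasis B) {u : B} (h : ∀ n, b.coord n u = 0) : u = 0 := by
  have h1 := SchauderBasis.tendsto_proj b.toBasis u
  have h2 : (fun n => SchauderBasis.proj b.toBasis n u) = fun _ => 0 := by
    funext n
    rw [SchauderBasis.proj_apply]
    exact Finset.sum_eq_zero fun i _ => by
      have := h i
      rw [coord] at this
      rw [this, zero_smul]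
  rw [h2] at h1
  exact (tendsto_nhds_unique h1 tendsto_const_nhds)

theorem summable_inner [CompleteSpace B] (b : SBasis B) (u v : B) :
    Summable fun n => (weight n : ℂ) * (conj (b.coord n u) * b.coord n v) := by
  obtain ⟨C, hC0, hC⟩ := b.exists_coord_bound
  refine Summable.of_norm_bounded (hasSum_weight.summable.mul_right ((C * ‖u‖) * (C * ‖v‖))) ?_
  intro n
  rw [norm_mul, norm_mul, RCLike.norm_conj, Complex.norm_real, Real.norm_eq_abs,
    abs_of_pos (weight_pos n)]
  have := mul_le_mul (hC n u) (hC n v) (norm_nonneg _) (by positivity)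
  exact mul_le_mul_of_nonneg_left this (weight_pos n).le

end SBasis

/-! ### The natural Hilbert space -/

section NaturalHilbert

variable {B : Type*} [NormedAddCommGroup B] [NormedSpace ℂ B]

/-- A copy of `B`, to be given the weighted inner product of a normalized Schauder basis. -/
def PreNatural (_b : SBasis B) : Type _ := B

namespace PreNatural

variable (b : SBasis B)

instance : AddCommGroup (PreNatural b) := inferInstanceAs (AddCommGroup B)

instance : Module ℂ (PreNatural b) := inferInstanceAs (Module ℂ B)

/-- The identity map from `B` to its copy. -/
def of : B ≃ₗ[ℂ] PreNatural b := LinearEquiv.refl ℂ B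

/-- The inner product `(u, v) = ∑ tₙ ⟨Eₙ*, u⟩ conj ⟨Eₙ*, v⟩`, which is linear in `u`; in Mathlib's
order of arguments it is `inner ℂ v u`. -/
@[reducible] def core [CompleteSpace B] : InnerProductSpace.Core ℂ (PreNatural b) where
  inner v u := ∑' n, (SBasis.weight n : ℂ) *
    (conj (b.coord n ((of b).symm v)) * b.coord n ((of b).symm u))
  conj_inner_symm v u := by
    rw [Complex.conj_tsum]
    refine tsum_congr fun n => ?_
    simp only [map_mul, Complex.conj_ofReal, Complex.conj_conj]
    ring
  re_inner_nonneg u := by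
    change 0 ≤ (∑' n, _ : ℂ).re
    rw [Complex.re_tsum (b.summable_inner _ _)]
    refine tsum_nonneg fun n => ?_
    rw [← Complex.normSq_eq_conj_mul_self, ← Complex.ofReal_mul, Complex.ofReal_re]
    exact mul_nonneg (SBasis.weight_pos n).le (Complex.normSq_nonneg _)
  add_left u v w := by
    rw [← (b.summable_inner _ _).tsum_add (b.summable_inner _ _)]
    refine tsum_congr fun n => ?_
    simp only [map_add]
    ring
  smul_left u v r := by
    rw [← tsum_mul_left]
    refine tsum_congr fun n => ?_
    simp only [map_smul, smul_eq_mul, map_mul]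
    ring
  definite u h := by
    have h' : (∑' n, (SBasis.weight n : ℂ) *
      (conj (b.coord n ((of b).symm u)) * b.coord n ((of b).symm u)) : ℂ) = 0 := h
    have hs := b.summable_inner ((of b).symm u) ((of b).symm u)
    simp only [← Complex.normSq_eq_conj_mul_self, ← Complex.ofReal_mul] at h' hs
    rw [← Complex.ofReal_tsum, Complex.ofReal_eq_zero] at h'
    have h0 : ∀ n, 0 ≤ SBasis.weight n * Complex.normSq (b.coord n ((of b).symm u)) :=
      fun n => mul_nonneg (SBasis.weight_pos n).le (Complex.normSq_nonneg _)
    have hs' := Complex.summable_ofReal.1 hs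
    have h1 := (hasSum_zero_iff_of_nonneg h0).1 (h' ▸ hs'.hasSum)
    have h2 : (of b).symm u = 0 := b.eq_zero_of_coord fun n => by
      have h3 := congrFun h1 n
      simpa [(SBasis.weight_pos n).ne'] using h3
    simpa using h2

instance [CompleteSpace B] : NormedAddCommGroup (PreNatural b) :=
  (core b).toNormedAddCommGroup

instance [CompleteSpace B] : InnerProductSpace ℂ (PreNatural b) :=
  InnerProductSpace.ofCore (core b).toCore

theorem inner_of [CompleteSpace B] (u v : B) :
    inner ℂ (of b v) (of b u)
      = ∑' n, (SBasis.weight n : ℂ) * (conj (b.coord n v) * b.coord n u) := rfl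

theorem exists_norm_of_le [CompleteSpace B] : ∃ C : ℝ, ∀ u : B, ‖of b u‖ ≤ C * ‖u‖ := by
  obtain ⟨C, hC0, hC⟩ := b.exists_coord_bound
  refine ⟨C, fun u => ?_⟩
  refine le_of_sq_le_sq ?_ (by positivity)
  have hw : HasSum (fun n => SBasis.weight n * (C * ‖u‖) ^ 2) ((C * ‖u‖) ^ 2) := by
    simpa using SBasis.hasSum_weight.mul_right ((C * ‖u‖) ^ 2)
  rw [← inner_self_eq_norm_sq (𝕜 := ℂ), inner_of]
  change (∑' n, _ : ℂ).re ≤ _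
  rw [Complex.re_tsum (b.summable_inner _ _)]
  refine ((Complex.reCLM.summable (b.summable_inner u u)).tsum_le_tsum ?_ hw.summable).trans_eq
    hw.tsum_eq
  intro n
  change ((SBasis.weight n : ℂ) * (conj (b.coord n u) * b.coord n u)).re ≤ _
  rw [← Complex.normSq_eq_conj_mul_self, ← Complex.ofReal_mul, Complex.ofReal_re,
    Complex.normSq_eq_norm_sq]
  exact mul_le_mul_of_nonneg_left (pow_le_pow_left₀ (norm_nonneg _) (hC n u) 2)
    (SBasis.weight_pos n).le

end PreNatural

/-- The natural Hilbert space of `B`: the completion of `B` for the weighted inner product. -/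
abbrev NaturalHilbert [CompleteSpace B] (b : SBasis B) : Type _ :=
  UniformSpace.Completion (PreNatural b)

variable [CompleteSpace B] (b : SBasis B)

/-- The embedding of `B` in its natural Hilbert space. -/
def embed : B →L[ℂ] NaturalHilbert b :=
  (UniformSpace.Completion.toComplL : PreNatural b →L[ℂ] NaturalHilbert b).comp
    ((PreNatural.of b).toLinearMap.mkContinuousOfExistsBound (PreNatural.exists_norm_of_le b))

theorem inner_embed (u v : B) :
    inner ℂ (embed b v) (embed b u)
      = ∑' n, (SBasis.weight n : ℂ) * (conj (b.coord n v) * b.coord n u) :=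
  (UniformSpace.Completion.inner_coe _ _).trans (PreNatural.inner_of b u v)

theorem embed_injective : Function.Injective (embed b) := fun _ _ h =>
  (PreNatural.of b).injective (UniformSpace.Completion.coe_injective _ h)

theorem denseRange_embed : DenseRange (embed b) :=
  UniformSpace.Completion.denseRange_coe.comp (PreNatural.of b).surjective.denseRange
    (UniformSpace.Completion.continuous_coe _)

/-! ### The representation of functionals, and the adjoint on `B` -/

/-- The functional `v ↦ (v, u)` on `B`, for `u ∈ B`. -/
def rieszFunctional (u : B) : StrongDual ℂ B := (innerSL ℂ (embed b u)).comp (embed b)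

theorem rieszFunctional_apply (u v : B) :
    rieszFunctional b u v = inner ℂ (embed b u) (embed b v) := rfl

theorem rieszFunctional_injective : Function.Injective (rieszFunctional b) := by
  intro u v h
  apply embed_injective b
  refine (denseRange_embed b).eq_of_inner_left ℂ fun w => ?_
  exact DFunLike.congr_fun h w

/-- The natural adjoint `A* = J⁻¹ A' J` of a bounded operator `A` on `B`, where `J` is the map
`u ↦ (·, u)` from `B` to its dual and `A'` is the transpose of `A`. It is a linear operator in `B`,
whose domain consists of all `v` for which `A' (J v)` lies in the range of `J`. -/
def naturalAdjoint (A : B →L[ℂ] B) : B →ₗ.[ℂ] B where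
  domain :=
    { carrier := {v | ∃ w, rieszFunctional b w = (rieszFunctional b v).comp A}
      zero_mem' := ⟨0, by ext x; simp [rieszFunctional_apply]⟩
      add_mem' := by
        rintro v v' ⟨w, hw⟩ ⟨w', hw'⟩
        refine ⟨w + w', ?_⟩
        ext x
        have h := DFunLike.congr_fun hw x
        have h' := DFunLike.congr_fun hw' x
        simp only [ContinuousLinearMap.comp_apply, rieszFunctional_apply] at h h' ⊢
        simp only [map_add, inner_add_left, h, h']
      smul_mem' := by
        rintro c v ⟨w, hw⟩
        refine ⟨c • w, ?_⟩
        ext x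
        have h := DFunLike.congr_fun hw x
        simp only [ContinuousLinearMap.comp_apply, rieszFunctional_apply] at h ⊢
        simp only [map_smul, inner_smul_left, h] }
  toFun :=
    { toFun := fun v => Classical.choose v.2
      map_add' := by
        intro v v'
        apply rieszFunctional_injective b
        ext x
        have h := DFunLike.congr_fun (Classical.choose_spec v.2) x
        have h' := DFunLike.congr_fun (Classical.choose_spec v'.2) x
        have h'' := DFunLike.congr_fun (Classical.choose_spec (v + v').2) x
        rw [h'']
        simp only [ContinuousLinearMap.comp_apply, rieszFunctional_apply] at h h' ⊢
        simp only [Submodule.coe_add, map_add, inner_add_left, h, h']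
      map_smul' := by
        intro c v
        apply rieszFunctional_injective b
        ext x
        have h := DFunLike.congr_fun (Classical.choose_spec v.2) x
        have h'' := DFunLike.congr_fun (Classical.choose_spec (c • v).2) x
        rw [h'']
        simp only [ContinuousLinearMap.comp_apply, rieszFunctional_apply] at h ⊢
        simp only [Submodule.coe_smul, map_smul, inner_smul_left, h, RingHom.id_apply] }

theorem naturalAdjoint_spec (A : B →L[ℂ] B) (v : (naturalAdjoint b A).domain) :
    rieszFunctional b (naturalAdjoint b A v) = (rieszFunctional b v).comp A :=
  Classical.choose_spec v.2

/-- The values at `u` of the duality map: the functionals `f` with `f u = ‖u‖² = ‖f‖²`. -/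
def dualityMap (u : B) : Set (StrongDual ℂ B) :=
  {f | f u = ((‖u‖ ^ 2 : ℝ) : ℂ) ∧ ‖f‖ ^ 2 = ‖u‖ ^ 2}

/-- `f` is the functional associated with the vector `u` of `B`, in one of two senses: a value of
the duality map at `u`, or the multiple of `(·, u)` that takes the value `1` at `u`. -/
def IsAssociatedFunctional (u : B) (f : StrongDual ℂ B) : Prop :=
  f ∈ dualityMap u ∨ f = ((‖embed b u‖ ^ 2 : ℝ) : ℂ)⁻¹ • rieszFunctional b u

end NaturalHilbert

/-! ### Schatten classes -/

section SchattenHilbert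

variable {H : Type*} [NormedAddCommGroup H] [InnerProductSpace ℂ H] [CompleteSpace H]

/-- The trace of a positive operator, `∑ (T eᵢ, eᵢ)` over a Hilbert basis (the choice of which does
not matter for positive `T`). -/
def positiveTrace (T : H →L[ℂ] H) : ℝ≥0∞ :=
  ∑' e : (Classical.choose (exists_hilbertBasis ℂ H) : Set H),
    ENNReal.ofReal (inner ℂ (e : H) (T e)).re

/-- The Schatten norm `(Tr (T* T) ^ (p / 2)) ^ (1 / p)`; the power of `T* T` is that of the
continuous functional calculus. -/
def schattenNorm (p : ℝ) (T : H →L[ℂ] H) : ℝ≥0∞ :=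
  positiveTrace ((star T * T) ^ (p / 2)) ^ (1 / p)

/-- The Schatten class of order `p` on a Hilbert space. -/
def schattenClass (H : Type*) [NormedAddCommGroup H] [InnerProductSpace ℂ H] [CompleteSpace H]
    (p : ℝ) : Set (H →L[ℂ] H) :=
  {T | IsCompactOperator T ∧ schattenNorm p T < ∞}

/-- `e` is an orthonormal family of eigenvectors of `|T| = (T* T) ^ (1 / 2)`, with eigenvalues `μ`,
that diagonalizes `|T|`: every nonzero eigenvalue is listed according to its multiplicity. -/
structure IsSingularSystem {ι : Type} (T : H →L[ℂ] H) (μ : ι → ℝ) (e : ι → H) : Prop where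
  orthonormal : Orthonormal ℂ e
  eigen : ∀ i, CFC.abs T (e i) = (μ i : ℂ) • e i
  expansion : ∀ x, HasSum (fun i => (μ i : ℂ) • inner ℂ (e i) x • e i) (CFC.abs T x)

end SchattenHilbert

section SchattenBanach

variable {B : Type*} [NormedAddCommGroup B] [NormedSpace ℂ B] [CompleteSpace B] (b : SBasis B)

/-- `Abar` is an extension of `A` from `B` to the natural Hilbert space (there is at most one, `B`
being dense). -/
def IsExtension (A : B →L[ℂ] B) (Abar : NaturalHilbert b →L[ℂ] NaturalHilbert b) : Prop :=
  ∀ u, Abar (embed b u) = embed b (A u)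

/-- The Schatten class of order `p` on `B`: the bounded operators on `B` that are restrictions to
`B` of operators in the Schatten class of the natural Hilbert space. -/
def banachSchattenClass (p : ℝ) : Set (B →L[ℂ] B) :=
  {A | ∃ Abar ∈ schattenClass (NaturalHilbert b) p, IsExtension b A Abar}

/-- The multiple of norm one of a nonzero vector. -/
def unitVector (u : B) : B := ((‖u‖ : ℂ)⁻¹) • u

/-- The number `⟨A* A u, f⟩`, for `u` in the domain of `A* A`. -/
def adjointForm (A : B →L[ℂ] B) (u : B) (hu : A u ∈ (naturalAdjoint b A).domain)
    (f : StrongDual ℂ B) : ℂ :=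
  f (naturalAdjoint b A ⟨A u, hu⟩)

/-- The Schatten norm `(∑ ⟨A* A φᵢ, φᵢ*⟩ ^ (p / 2)) ^ (1 / p)` on `B`, computed with the vectors
`φᵢ` and the functionals `φᵢ*`. -/
def banachSchattenNorm (p : ℝ) (A : B →L[ℂ] B) {ι : Type} (φ : ι → B)
    (hφ : ∀ i, A (φ i) ∈ (naturalAdjoint b A).domain) (φs : ι → StrongDual ℂ B) : ℝ≥0∞ :=
  (∑' i, ENNReal.ofReal ((adjointForm b A (φ i) (hφ i) (φs i)).re ^ (p / 2))) ^ (1 / p)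

end SchattenBanach

end

/-!
Write `T` for the extension of `A` to the natural Hilbert space `H`, and `J` for the map
`u ↦ (·, u)` from `B` to its dual.

**Equality of the norms.** The vectors `eᵢ` of a singular system satisfy `T* T eᵢ = μᵢ² eᵢ` with
`eᵢ ∈ B`. Tested against the dense subspace `B`, this says `J (μᵢ² eᵢ) = A' J (A eᵢ)`, so
`A eᵢ ∈ D(A*)` and `A* A eᵢ = μᵢ² eᵢ` (`IsExtension.naturalAdjoint_apply`). An associated functional
takes the value `1` at the unit vector `φᵢ`, hence `⟨A* A φᵢ, φᵢ*⟩ = μᵢ²` for either kind of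
functional. On the Hilbert space side, the functional calculus acts on eigenvectors through the
eigenvalue (`ContinuousLinearMap.cfc_apply_of_apply_eq_smul`), so `(T* T) ^ (p / 2)` is diagonal
in `(eᵢ)` with entries `(μᵢ²) ^ (p / 2)`, and it vanishes on the orthogonal complement. Parseval's
identity then gives its trace (`positiveTrace_eq_tsum`).

**Existence of a singular system.** Orthonormal bases of the eigenspaces of `T* T` for nonzero
eigenvalues form a singular system of `T` in `H` (`IsCompactOperator.exists_isSingularSystem`). It
remains to see that these eigenvectors lie in `B`. If `D(A*) = B`, then `A*` is bounded by the
closed graph theorem, so `A* A` is a compact operator on `B` whose extension to `H` is `T* T`.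
A theorem of Lax (`exists_eq_of_compact_restriction`) then applies. Its proof splits off from `B`
the eigenspace of `A* A` for the eigenvalue in question; on the complement the Fredholm alternative
makes `A* A - c` surjective, so that an eigenvector of `T* T` orthogonal to the eigenvectors
in `B` is orthogonal to all of `B`.
-/

/-! ### Eigenvectors and the continuous functional calculus -/

section Hilbert

variable {H : Type*} [NormedAddCommGroup H] [InnerProductSpace ℂ H]

theorem ContinuousLinearMap.mem_spectrum_real_of_apply_eq_smul {a : H →L[ℂ] H} {c : ℝ} {x : H}
    (hx : x ≠ 0) (h : a x = (c : ℂ) • x) : c ∈ spectrum ℝ a := by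
  rw [spectrum.mem_iff]
  intro hu
  obtain ⟨u, hu⟩ := hu
  apply hx
  have h1 : (u : H →L[ℂ] H) x = 0 := by
    rw [hu, sub_apply, h, Algebra.algebraMap_eq_smul_one]
    simp
  have h2 : ((↑u⁻¹ : H →L[ℂ] H) * (u : H →L[ℂ] H)) x = 0 := by
    rw [mul_apply_eq_comp, h1, map_zero]
  simpa using h2

variable [CompleteSpace H]

/-- The functional calculus acts on an eigenvector through the value of the function at the
eigenvalue. -/
theorem ContinuousLinearMap.cfc_apply_of_apply_eq_smul {a : H →L[ℂ] H} (ha : IsSelfAdjoint a)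
    {f : ℝ → ℝ} (hf : ContinuousOn f (spectrum ℝ a)) {c : ℝ} {x : H}
    (h : a x = (c : ℂ) • x) : cfc f a x = (f c : ℂ) • x := by
  rcases eq_or_ne x 0 with rfl | hx
  · simp
  have hc := ContinuousLinearMap.mem_spectrum_real_of_apply_eq_smul hx h
  have key : ∀ g : C(spectrum ℝ a, ℝ), cfcHom ha g x = (g ⟨c, hc⟩ : ℂ) • x := by
    intro g
    induction g using ContinuousMap.induction_on_of_compact with
    | const r =>
      have : cfcHom (R := ℝ) ha (ContinuousMap.const _ r) = algebraMap ℝ (H →L[ℂ] H) r :=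
        AlgHomClass.commutes (cfcHom (R := ℝ) ha) r
      rw [this, Algebra.algebraMap_eq_smul_one]
      simp
    | id =>
      have : cfcHom (R := ℝ) ha ((ContinuousMap.id ℝ).restrict (spectrum ℝ a)) = a :=
        cfcHom_id ha
      rw [this, h]
      rfl
    | star_id =>
      rw [map_star]
      have : cfcHom (R := ℝ) ha ((ContinuousMap.id ℝ).restrict (spectrum ℝ a)) = a :=
        cfcHom_id ha
      rw [this, ha.star_eq, h]
      rfl
    | add f g hf hg => rw [map_add, add_apply, hf, hg]; simp [add_smul]
    | mul f g hf hg =>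
      rw [map_mul, mul_apply_eq_comp, hg, map_smul, hf]
      rw [ContinuousMap.mul_apply, Complex.ofReal_mul, mul_smul, smul_comm]
    | frequently f hf =>
      have hcl : IsClosed {g : C(spectrum ℝ a, ℝ) |
          cfcHom ha g x = (g ⟨c, hc⟩ : ℂ) • x} := by
        have h1 := cfcHom_continuous (R := ℝ) ha
        refine isClosed_eq (h1.clm_apply continuous_const) ?_
        exact (Complex.continuous_ofReal.comp (continuous_eval_const _)).smul
          continuous_const
      exact hcl.closure_subset (mem_closure_iff_frequently.2 hf)
  rw [cfc_apply f a ha hf]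
  exact key _

theorem ContinuousLinearMap.rpow_apply_of_apply_eq_smul {a : H →L[ℂ] H} (ha : 0 ≤ a) {y : ℝ}
    (hy : 0 ≤ y) {c : ℝ} {x : H} (h : a x = (c : ℂ) • x) :
    (a ^ y) x = ((c ^ y : ℝ) : ℂ) • x := by
  rw [CFC.rpow_eq_cfc_real ha]
  exact ContinuousLinearMap.cfc_apply_of_apply_eq_smul (.of_nonneg ha)
    (Real.continuous_rpow_const hy).continuousOn h

/-! ### Orthonormal expansions -/

/-- The Fourier series of `x` in an orthonormal family converges to the difference of `x` and a
vector orthogonal to the family. -/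
theorem Orthonormal.exists_hasSum_sub {ι : Type*} {e : ι → H} (he : Orthonormal ℂ e) (x : H) :
    ∃ y, (∀ i, inner ℂ (e i) y = 0) ∧ HasSum (fun i => inner ℂ (e i) x • e i) (x - y) := by
  classical
  have hs : Summable fun i => inner ℂ (e i) x • e i := by
    have := (he.orthogonalFamily.summable_iff_norm_sq_summable
      (fun i => inner ℂ (e i) x)).2 (he.inner_products_summable x)
    simpa using this
  refine ⟨x - ∑' i, inner ℂ (e i) x • e i, fun j => ?_, by simpa using hs.hasSum⟩
  have h1 := hs.hasSum.mapL (innerSL ℂ (e j))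
  have h2 : HasSum (fun i => innerSL ℂ (e j) (inner ℂ (e i) x • e i)) (inner ℂ (e j) x) := by
    convert hasSum_ite_eq j (inner ℂ (e j) x) using 2 with i
    rw [innerSL_apply_apply, inner_smul_right, orthonormal_iff_ite.1 he]
    by_cases hij : i = j
    · subst hij; simp
    · simp [hij, Ne.symm hij]
  rw [inner_sub_right, sub_eq_zero]
  exact h2.unique h1

/-! ### The trace of a power of the absolute value -/

/-- If `S` is diagonal in an orthonormal family and vanishes on the orthogonal complement, its
trace is the sum of the diagonal entries. -/
theorem positiveTrace_eq_tsum {ι : Type*} {e : ι → H} (he : Orthonormal ℂ e) {S : H →L[ℂ] H}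
    {d : ι → ℝ} (hd : ∀ i, 0 ≤ d i) (hS : ∀ i, S (e i) = (d i : ℂ) • e i)
    (hS0 : ∀ y, (∀ i, inner ℂ (e i) y = 0) → S y = 0) :
    positiveTrace S = ∑' i, ENNReal.ofReal (d i) := by
  obtain ⟨β, hβ⟩ := Classical.choose_spec (exists_hilbertBasis ℂ H)
  have hentry : ∀ v : H, ENNReal.ofReal (inner ℂ v (S v)).re
      = ∑' i, ENNReal.ofReal (d i) * ENNReal.ofReal (‖(inner ℂ (e i) v : ℂ)‖ ^ 2) := by
    intro v
    obtain ⟨y, hy, hv⟩ := he.exists_hasSum_sub v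
    have h1 := (hv.mapL S).mapL (innerSL ℂ v)
    rw [map_sub, hS0 y hy, sub_zero] at h1
    have h2 := h1.mapL Complex.reCLM
    have h3 : (fun i => Complex.reCLM (innerSL ℂ v (S (inner ℂ (e i) v • e i))))
        = fun i => d i * ‖(inner ℂ (e i) v : ℂ)‖ ^ 2 := by
      funext i
      rw [map_smul, hS, innerSL_apply_apply, inner_smul_right, inner_smul_right,
        ← inner_conj_symm v (e i)]
      have : inner ℂ (e i) v * ((d i : ℂ) * conj (inner ℂ (e i) v))
          = ((d i * ‖(inner ℂ (e i) v : ℂ)‖ ^ 2 : ℝ) : ℂ) := by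
        rw [mul_left_comm, Complex.mul_conj, Complex.normSq_eq_norm_sq]
        push_cast
        ring
      rw [this, Complex.reCLM_apply, Complex.ofReal_re]
    rw [h3] at h2
    have h4 : (inner ℂ v (S v)).re = ∑' i, d i * ‖(inner ℂ (e i) v : ℂ)‖ ^ 2 := h2.tsum_eq.symm
    rw [h4, ENNReal.ofReal_tsum_of_nonneg (fun i => mul_nonneg (hd i) (sq_nonneg _)) h2.summable]
    exact tsum_congr fun i => ENNReal.ofReal_mul (hd i)
  unfold positiveTrace
  simp_rw [hentry]
  rw [ENNReal.tsum_comm]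
  refine tsum_congr fun i => ?_
  rw [ENNReal.tsum_mul_left]
  -- Parseval's identity for the unit vector `e i`.
  have hP := (β.hasSum_inner_mul_inner (e i) (e i)).mapL Complex.reCLM
  have hP' : HasSum (fun v : (Classical.choose (exists_hilbertBasis ℂ H) : Set H) =>
      ‖(inner ℂ (e i) (v : H) : ℂ)‖ ^ 2) 1 := by
    convert hP using 1
    · funext v
      rw [hβ, ← inner_conj_symm (v : H) (e i), Complex.mul_conj, Complex.normSq_eq_norm_sq,
        Complex.reCLM_apply, Complex.ofReal_re]
    · rw [inner_self_eq_norm_sq_to_K, he.1 i]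
      simp
  rw [← ENNReal.ofReal_tsum_of_nonneg (fun v => sq_nonneg _) hP'.summable, hP'.tsum_eq]
  simp

namespace IsSingularSystem

variable {ι : Type} {T : H →L[ℂ] H} {μ : ι → ℝ} {e : ι → H}

theorem star_mul_self_apply (h : IsSingularSystem T μ e) (i : ι) :
    (star T * T) (e i) = ((μ i ^ 2 : ℝ) : ℂ) • e i := by
  rw [← CFC.abs_mul_abs, mul_apply_eq_comp, h.eigen, map_smul, h.eigen, smul_smul]
  push_cast
  rw [sq]

theorem abs_apply_eq_zero (h : IsSingularSystem T μ e) {y : H}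
    (hy : ∀ i, inner ℂ (e i) y = 0) : CFC.abs T y = 0 := by
  have := h.expansion y
  simp only [hy, zero_smul, smul_zero] at this
  exact this.unique hasSum_zero

/-- The sum is written with `(μ i ^ 2) ^ (p / 2)`, the power of the eigenvalue `μ i ^ 2` of
`T* T`. -/
theorem schattenNorm_eq (h : IsSingularSystem T μ e) {p : ℝ} (hp : 0 < p) :
    schattenNorm p T = (∑' i, ENNReal.ofReal ((μ i ^ 2) ^ (p / 2))) ^ (1 / p) := by
  unfold schattenNorm
  rw [positiveTrace_eq_tsum h.orthonormal (fun i => Real.rpow_nonneg (sq_nonneg (μ i)) _)]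
  · exact fun i => ContinuousLinearMap.rpow_apply_of_apply_eq_smul (star_mul_self_nonneg T)
      (by positivity) (h.star_mul_self_apply i)
  · intro y hy
    have h0 : (star T * T) y = ((0 : ℝ) : ℂ) • y := by
      rw [← CFC.abs_mul_abs, mul_apply_eq_comp, h.abs_apply_eq_zero hy]
      simp
    rw [ContinuousLinearMap.rpow_apply_of_apply_eq_smul (star_mul_self_nonneg T)
      (by positivity) h0, Real.zero_rpow (by positivity)]
    simp

end IsSingularSystem

/-! ### Singular systems of compact operators on a Hilbert space -/

/-- The singular system consists of orthonormal bases of the eigenspaces of `T* T` for the nonzero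
eigenvalues. The index type is built from real numbers and finite ordinals, so that it lives in
`Type` whatever the universe of `H`. -/
theorem IsCompactOperator.exists_isSingularSystem {T : H →L[ℂ] H} (hT : IsCompactOperator T) :
    ∃ (ι : Type) (μ : ι → ℝ) (e : ι → H), IsSingularSystem T μ e ∧ ∀ i, μ i ≠ 0 := by
  set G : H →L[ℂ] H := star T * T
  have hGc : IsCompactOperator G := hT.clm_comp (star T)
  have hG0 : 0 ≤ G := star_mul_self_nonneg T
  have hGs : (G : H →ₗ[ℂ] H).IsSymmetric :=
    ContinuousLinearMap.isSelfAdjoint_iff_isSymmetric.1 (.of_nonneg hG0)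
  let E : {c : ℝ // c ≠ 0} → Submodule ℂ H :=
    fun c => Module.End.eigenspace (G : H →ₗ[ℂ] H) ((c : ℝ) : ℂ)
  have hfin : ∀ c, FiniteDimensional ℂ (E c) := fun c =>
    ContinuousLinearMap.finite_dimensional_eigenspace hGc _ (by exact_mod_cast c.2)
  let β : ∀ c, OrthonormalBasis (Fin (Module.finrank ℂ (E c))) ℂ (E c) :=
    fun c => stdOrthonormalBasis ℂ (E c)
  have hort : OrthogonalFamily ℂ (fun c => E c) fun c => (E c).subtypeₗᵢ :=
    hGs.orthogonalFamily_eigenspaces.comp (γ := {c : ℝ // c ≠ 0})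
      (f := fun c => ((c : ℝ) : ℂ)) fun c c' h => Subtype.ext (Complex.ofReal_injective h)
  let e : (Σ c, Fin (Module.finrank ℂ (E c))) → H := fun i => (β i.1 i.2 : H)
  have he : Orthonormal ℂ e := hort.orthonormal_sigma_orthonormal fun c => (β c).orthonormal
  have hGe : ∀ i, G (e i) = ((i.1 : ℝ) : ℂ) • e i := fun i =>
    Module.End.mem_eigenspace_iff.1 (β i.1 i.2).2
  have habs : CFC.abs T = G ^ (1 / 2 : ℝ) := CFC.sqrt_eq_rpow
  have heig : ∀ i, CFC.abs T (e i) = ((((i.1 : ℝ) ^ (1 / 2 : ℝ) : ℝ)) : ℂ) • e i := fun i => by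
    rw [habs]
    exact ContinuousLinearMap.rpow_apply_of_apply_eq_smul hG0 (by norm_num) (hGe i)
  have hpos : ∀ i : (Σ c, Fin (Module.finrank ℂ (E c))), 0 < (i.1 : ℝ) := fun i => by
    have hne : e i ≠ 0 := he.ne_zero i
    have := spectrum_nonneg_of_nonneg hG0
      (ContinuousLinearMap.mem_spectrum_real_of_apply_eq_smul hne (hGe i))
    exact lt_of_le_of_ne this i.1.2.symm
  -- A vector orthogonal to the family is annihilated by `G`: its image is orthogonal to all the
  -- eigenspaces, also to the kernel of `G`.
  have hker : ∀ y, (∀ i, inner ℂ (e i) y = 0) → G y = 0 := by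
    intro y hy
    have hmem : G y ∈ (⨆ c, Module.End.eigenspace (G : H →ₗ[ℂ] H) c)ᗮ := by
      rw [← Submodule.iInf_orthogonal, Submodule.mem_iInf]
      intro c
      rw [Submodule.mem_orthogonal]
      intro z hz
      have hGz : G z = c • z := Module.End.mem_eigenspace_iff.1 hz
      have hsym : inner ℂ z (G y) = conj c * inner ℂ z y := by
        rw [← inner_smul_left, ← hGz]
        exact (hGs z y).symm
      rw [hsym]
      rcases eq_or_ne z 0 with rfl | hz0
      · simp
      rcases eq_or_ne c 0 with rfl | hc0
      · simp
      have hcr : conj c = c := hGs.conj_eigenvalue_eq_self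
        (Module.End.hasEigenvalue_of_hasEigenvector ⟨hz, hz0⟩)
      obtain ⟨r, rfl⟩ := Complex.conj_eq_iff_real.1 hcr
      have hr : r ≠ 0 := by exact_mod_cast hc0
      have hzs : z = ∑ k, (β ⟨r, hr⟩).repr ⟨z, hz⟩ k • e ⟨⟨r, hr⟩, k⟩ := by
        have := congrArg (Subtype.val) ((β ⟨r, hr⟩).sum_repr ⟨z, hz⟩)
        simpa [e] using this.symm
      rw [hzs, sum_inner]
      simp [inner_smul_left, hy]
    rwa [ContinuousLinearMap.orthogonalComplement_iSup_eigenspaces_eq_bot hGc hGs,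
      Submodule.mem_bot] at hmem
  refine ⟨_, fun i => (i.1 : ℝ) ^ (1 / 2 : ℝ), e, ⟨he, heig, fun x => ?_⟩,
    fun i => (Real.rpow_pos_of_pos (hpos i) _).ne'⟩
  obtain ⟨y, hy, hx⟩ := he.exists_hasSum_sub x
  have h0 : CFC.abs T y = 0 := by
    have : G y = ((0 : ℝ) : ℂ) • y := by simp [hker y hy]
    rw [habs, ContinuousLinearMap.rpow_apply_of_apply_eq_smul hG0 (by norm_num) this,
      Real.zero_rpow (by norm_num)]
    simp
  have h1 := hx.mapL (CFC.abs T)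
  rw [map_sub, h0, sub_zero] at h1
  convert h1 using 2 with i
  rw [map_smul, heig, smul_comm]

/-! ### Eigenvectors of symmetrizable compact operators -/

/-- Lax's theorem: if a compact operator `K` on a Banach space `B` is the restriction to `B` of a
symmetric compact operator `G` on a Hilbert space containing `B` densely, then the eigenvectors of
`G` for nonzero eigenvalues lie in `B`. -/
theorem exists_eq_of_compact_restriction {B : Type*} [NormedAddCommGroup B] [NormedSpace ℂ B]
    [CompleteSpace B] {j : B →L[ℂ] H} (hj : Function.Injective j) (hjd : DenseRange j)
    {K : B →L[ℂ] B} (hK : IsCompactOperator K) {G : H →L[ℂ] H} (hGc : IsCompactOperator G)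
    (hG : (G : H →ₗ[ℂ] H).IsSymmetric) (hjK : ∀ u, G (j u) = j (K u)) {c : ℝ} (hc : c ≠ 0)
    {x : H} (hx : G x = (c : ℂ) • x) : ∃ u, j u = x := by
  have hc' : (c : ℂ) ≠ 0 := by exact_mod_cast hc
  let N : Submodule ℂ H :=
    Module.End.eigenspace (G : H →ₗ[ℂ] H) (c : ℂ) ⊓ LinearMap.range (j : B →ₗ[ℂ] H)
  have hNG : ∀ z ∈ N, G z = (c : ℂ) • z := fun z hz => Module.End.mem_eigenspace_iff.1 hz.1
  have : FiniteDimensional ℂ (Module.End.eigenspace (G : H →ₗ[ℂ] H) (c : ℂ)) :=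
    ContinuousLinearMap.finite_dimensional_eigenspace hGc _ hc'
  have : FiniteDimensional ℂ N := Submodule.finiteDimensional_of_le inf_le_left
  -- The eigenvectors of `G` in `B` are split off; `K - c` is invertible on the rest of `B`.
  let M : Submodule ℂ B := Nᗮ.comap (j : B →ₗ[ℂ] H)
  have hM : ∀ u, u ∈ M ↔ ∀ z ∈ N, inner ℂ z (j u) = 0 := fun u => Submodule.mem_orthogonal _ _
  have hMc : IsClosed (M : Set B) := N.isClosed_orthogonal.preimage j.continuous
  have : CompleteSpace M := hMc.completeSpace_coe
  have hKM : ∀ u ∈ M, K u ∈ M := by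
    intro u hu
    rw [hM] at hu ⊢
    intro z hz
    have h1 : inner ℂ (G z) (j u) = inner ℂ z (G (j u)) := hG z (j u)
    rw [← hjK, ← h1, hNG z hz, inner_smul_left, hu z hz, mul_zero]
  let KM : M →L[ℂ] M := K.restrict hKM
  have hKMc : IsCompactOperator KM := hK.restrict' (f := (K : B →ₗ[ℂ] B)) hKM
  have hne : ¬ Module.End.HasEigenvalue (KM : M →ₗ[ℂ] M) (c : ℂ) := by
    intro h
    obtain ⟨u, hu, hu0⟩ := h.exists_hasEigenvector
    have hu1 : KM u = (c : ℂ) • u := Module.End.mem_eigenspace_iff.1 hu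
    have hu2 : K u = (c : ℂ) • (u : B) := congrArg Subtype.val hu1
    have hu3 : j u ∈ N := ⟨Module.End.mem_eigenspace_iff.2 (by
      change G (j u) = _
      rw [hjK, hu2, map_smul]), ⟨u, rfl⟩⟩
    have hu4 : j u = 0 := inner_self_eq_zero.1 ((hM u).1 u.2 _ hu3)
    exact hu0 (Subtype.ext (hj (by simpa using hu4)))
  have hres := (hKMc.hasEigenvalue_or_mem_resolventSet hc').resolve_left hne
  have hsurj : ∀ m ∈ M, ∃ u : B, m = (c : ℂ) • u - K u := by
    intro m hm
    rw [spectrum.mem_resolventSet_iff, ContinuousLinearMap.isUnit_iff_bijective] at hres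
    obtain ⟨u, hu⟩ := hres.2 ⟨m, hm⟩
    refine ⟨u, ?_⟩
    have := congrArg Subtype.val hu
    simpa [Algebra.algebraMap_eq_smul_one, KM] using this.symm
  have hproj : ∀ y, ∃ u, j u ∈ N ∧ y - j u ∈ Nᗮ := fun y => by
    obtain ⟨u, hu⟩ := (N.orthogonalProjectionOnto y).2.2
    have hu' : j u = N.orthogonalProjectionOnto y := hu
    refine ⟨u, hu' ▸ (N.orthogonalProjectionOnto y).2, ?_⟩
    rw [hu']
    exact N.sub_starProjection_mem_orthogonal y
  obtain ⟨u, huN, hu⟩ := hproj x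
  refine ⟨u, (sub_eq_zero.1 ?_).symm⟩
  have hGz : G (x - j u) = (c : ℂ) • (x - j u) := by
    rw [map_sub, hx, hNG _ huN, smul_sub]
  refine hjd.eq_zero_of_inner_left ℂ fun v => ?_
  obtain ⟨w, hwN, hw⟩ := hproj (j v)
  obtain ⟨m, hm⟩ := hsurj (v - w) ((hM _).2 fun z hz => by
    rw [map_sub]; exact (Submodule.mem_orthogonal _ _).1 hw z hz)
  have h1 : inner ℂ (x - j u) (j w) = 0 := (Submodule.mem_orthogonal' _ _).1 hu _ hwN
  have h2 : inner ℂ (x - j u) (j (v - w)) = 0 := by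
    have h3 : inner ℂ (G (x - j u)) (j m) = inner ℂ (x - j u) (G (j m)) := hG _ _
    rw [hm, map_sub, map_smul, ← hjK, inner_sub_right, ← h3, hGz, inner_smul_left,
      inner_smul_right]
    simp
  have h4 : j v = j (v - w) + j w := by simp
  rw [h4, inner_add_right, h1, h2, add_zero]

end Hilbert

/-! ### The adjoint on `B` and the Hilbert space adjoint -/

section Banach

variable {B : Type*} [NormedAddCommGroup B] [NormedSpace ℂ B]

theorem norm_unitVector {u : B} (hu : u ≠ 0) : ‖unitVector u‖ = 1 := by
  have : ‖u‖ ≠ 0 := norm_ne_zero_iff.2 hu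
  simp [unitVector, norm_smul, this]

variable [CompleteSpace B] {b : SBasis B}

theorem IsAssociatedFunctional.apply_self {u : B} (hu : ‖u‖ = 1) {f : StrongDual ℂ B}
    (hf : IsAssociatedFunctional b u f) : f u = 1 := by
  rcases hf with hf | rfl
  · simpa [hu] using hf.1
  · have h0 : embed b u ≠ 0 := fun h => by
      have : u = 0 := embed_injective b (by simpa using h)
      simp [this] at hu
    have h1 : ((‖embed b u‖ ^ 2 : ℝ) : ℂ) ≠ 0 := by
      simpa using h0
    rw [smul_apply, rieszFunctional_apply, inner_self_eq_norm_sq_to_K,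
      smul_eq_mul]
    push_cast at h1 ⊢
    exact inv_mul_cancel₀ h1

theorem IsExtension.unique {A : B →L[ℂ] B} {S T : NaturalHilbert b →L[ℂ] NaturalHilbert b}
    (hS : IsExtension b A S) (hT : IsExtension b A T) : S = T :=
  ContinuousLinearMap.coe_injective (LinearMap.ext fun x => congrFun
    ((denseRange_embed b).equalizer S.continuous T.continuous
      (funext fun u => (hS u).trans (hT u).symm)) x)

theorem IsExtension.inner_star_mul_self {A : B →L[ℂ] B}
    {T : NaturalHilbert b →L[ℂ] NaturalHilbert b} (hT : IsExtension b A T) (u v : B) :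
    inner ℂ ((star T * T) (embed b u)) (embed b v) = inner ℂ (embed b (A u)) (embed b (A v)) := by
  rw [mul_apply_eq_comp, ContinuousLinearMap.star_eq_adjoint,
    ContinuousLinearMap.adjoint_inner_left, hT, hT]

/-- `T* T` maps the vector `u` of `B` to the vector `w` of `B` exactly if `w = A* A u`, the latter
being written through the defining relation of the adjoint on `B`. -/
theorem IsExtension.star_mul_self_embed_eq_iff {A : B →L[ℂ] B}
    {T : NaturalHilbert b →L[ℂ] NaturalHilbert b} (hT : IsExtension b A T) {u w : B} :
    (star T * T) (embed b u) = embed b w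
      ↔ rieszFunctional b w = (rieszFunctional b (A u)).comp A := by
  constructor
  · intro h
    ext v
    rw [rieszFunctional_apply, ← h, hT.inner_star_mul_self]
    rfl
  · intro h
    refine (denseRange_embed b).eq_of_inner_left ℂ fun v => ?_
    rw [hT.inner_star_mul_self]
    exact (DFunLike.congr_fun h v).symm

/-- An eigenvector of `T* T` in `B` is an eigenvector of `A* A`. -/
theorem IsExtension.naturalAdjoint_apply {A : B →L[ℂ] B}
    {T : NaturalHilbert b →L[ℂ] NaturalHilbert b} (hT : IsExtension b A T) {u : B} {c : ℂ}
    (hu : (star T * T) (embed b u) = c • embed b u) :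
    ∃ h : A u ∈ (naturalAdjoint b A).domain, naturalAdjoint b A ⟨A u, h⟩ = c • u := by
  rw [← map_smul, hT.star_mul_self_embed_eq_iff] at hu
  exact ⟨⟨_, hu⟩, rieszFunctional_injective b ((naturalAdjoint_spec b A ⟨A u, _⟩).trans hu.symm)⟩

/-- An everywhere defined adjoint is bounded, by the closed graph theorem. -/
theorem exists_continuous_naturalAdjoint {A : B →L[ℂ] B} (h : (naturalAdjoint b A).domain = ⊤) :
    ∃ S : B →L[ℂ] B, ∀ v, rieszFunctional b (S v) = (rieszFunctional b v).comp A := by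
  let S₀ : B →ₗ[ℂ] B := (naturalAdjoint b A).toFun ∘ₗ
    LinearMap.codRestrict _ LinearMap.id fun v => h ▸ Submodule.mem_top
  have hS₀ : ∀ v, rieszFunctional b (S₀ v) = (rieszFunctional b v).comp A :=
    fun v => naturalAdjoint_spec b A _
  have hS₀' : ∀ v x, inner ℂ (embed b (S₀ v)) (embed b x) = inner ℂ (embed b v) (embed b (A x)) :=
    fun v x => DFunLike.congr_fun (hS₀ v) x
  refine ⟨⟨S₀, S₀.continuous_of_seq_closed_graph fun u x y hu hSu => ?_⟩, hS₀⟩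
  apply rieszFunctional_injective b
  rw [hS₀]
  ext v
  have h1 := (((embed b).continuous.tendsto y).comp hSu).inner (𝕜 := ℂ)
    (tendsto_const_nhds (x := embed b v))
  have h2 := (((embed b).continuous.tendsto x).comp hu).inner (𝕜 := ℂ)
    (tendsto_const_nhds (x := embed b (A v)))
  refine tendsto_nhds_unique h1 (h2.congr fun n => ?_)
  exact (hS₀' (u n) v).symm

end Banach

/-! ### Schatten norms on `B` and singular systems in `B` -/

theorem mainTheorem3 {B : Type*} [NormedAddCommGroup B] [NormedSpace ℂ B] [CompleteSpace B]
    [UniformConvexSpace B] (b : SBasis B) (p : ℝ) (hp : 0 < p)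
    (A : B →L[ℂ] B) (hA : A ∈ banachSchattenClass b p)
    (Abar : NaturalHilbert b →L[ℂ] NaturalHilbert b) (hAbar : IsExtension b A Abar) :
    (∀ (ι : Type) (μ : ι → ℝ) (e : ι → B), IsSingularSystem Abar μ (fun i => embed b (e i)) →
      ∃ hφ : ∀ i, A (unitVector (e i)) ∈ (naturalAdjoint b A).domain,
        ∀ φs : ι → StrongDual ℂ B,
          (∀ i, IsAssociatedFunctional b (unitVector (e i)) (φs i)) →
          (∀ i, 0 ≤ adjointForm b A (unitVector (e i)) (hφ i) (φs i)) ∧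
          banachSchattenNorm b p A (fun i => unitVector (e i)) hφ φs = schattenNorm p Abar ∧
          schattenNorm p Abar < ∞) ∧
    (IsCompactOperator A → (naturalAdjoint b A).domain = ⊤ →
      ∃ (ι : Type) (μ : ι → ℝ) (e : ι → B),
        IsSingularSystem Abar μ (fun i => embed b (e i))) := by
  obtain ⟨T, ⟨hTc, hTp⟩, hT⟩ := hA
  obtain rfl := hAbar.unique hT
  refine ⟨fun ι μ e he => ?_, fun hAc hdom => ?_⟩
  · have hφ : ∀ i, ∃ h : A (unitVector (e i)) ∈ (naturalAdjoint b A).domain,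
        naturalAdjoint b A ⟨A (unitVector (e i)), h⟩
          = ((μ i ^ 2 : ℝ) : ℂ) • unitVector (e i) := fun i => by
      apply hAbar.naturalAdjoint_apply
      rw [unitVector, map_smul, map_smul, he.star_mul_self_apply i, smul_comm]
    refine ⟨fun i => (hφ i).1, fun φs hφs => ?_⟩
    have hform : ∀ i, adjointForm b A (unitVector (e i)) (hφ i).1 (φs i)
        = ((μ i ^ 2 : ℝ) : ℂ) := fun i => by
      have hne : e i ≠ 0 := fun h => he.orthonormal.ne_zero i (by simp [h])
      rw [adjointForm, (hφ i).2, map_smul, (hφs i).apply_self (norm_unitVector hne), smul_eq_mul,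
        mul_one]
    refine ⟨fun i => ?_, ?_, hTp⟩
    · rw [hform]
      exact_mod_cast sq_nonneg (μ i)
    · rw [he.schattenNorm_eq hp]
      simp only [banachSchattenNorm, hform, Complex.ofReal_re]
  · obtain ⟨S, hS⟩ := exists_continuous_naturalAdjoint hdom
    obtain ⟨ι, μ, x, hx, hμ⟩ := hTc.exists_isSingularSystem
    have hpre : ∀ i, ∃ u, embed b u = x i := fun i =>
      exists_eq_of_compact_restriction (embed_injective b) (denseRange_embed b)
        (K := S * A) (hAc.clm_comp S) (G := star Abar * Abar) (hTc.clm_comp (star Abar))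
        (ContinuousLinearMap.isSelfAdjoint_iff_isSymmetric.1 (.star_mul_self Abar))
        (fun u => hAbar.star_mul_self_embed_eq_iff.2 (hS (A u)))
        (pow_ne_zero 2 (hμ i)) (hx.star_mul_self_apply i)
    choose e he using hpre
    refine ⟨ι, μ, e, ?_⟩
    simpa only [he] using hx
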